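/- Let $K$ be a field, $S=K[x_1,\dots,x_n]$, and let $Q$ be a partial order $\leq_Q$ on the set of variables $\{x_1,\dots,x_n\}$. A monomial ideal $I\subseteq S$ is called \emph{$Q$-Borel} if for every monomial $u\in I$, every variable $x_i$ dividing $u$ and every $x_j\leq_Q x_i$, the monomial $x_j\cdot(u/x_i)$ lies in $I$. For a monomial $m\in S$ let $Q(m)$ denote the smallest $Q$-Borel ideal of $S$ containing $m$. For an ideal $I \subseteq S$ let $\operatorname{ass}(I)$ be the set of prime ideals of the form $I:\langle f\rangle=\{g\in S \mid gf\in I\}$ with $f\in S$. Theorem. Let $m\in S$ be a monomial and $I=Q(m)$. Then \[\operatorname{ass}(I)=\operatorname{ass}(I^s)\quad\text{for all } s\geq 1.\] In particular, $I$ has the persistence property: $\operatorname{ass}(I^i)\subseteq\operatorname{ass}(I^{i+1})$ for all $i\geq 1$. -/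

import Mathlib

/-- An ideal of `K[x_i : i ∈ σ]` is a monomial ideal if it is generated by monomials
(a monomial is represented by its exponent vector). -/
def IsMonomialIdeal {σ K : Type*} [Field K] (I : Ideal (MvPolynomial σ K)) : Prop :=
  ∃ G : Set (σ →₀ ℕ), I = Ideal.span ((fun e ↦ MvPolynomial.monomial e (1 : K)) '' G)

/-- The monomial `x_j * (x^e / x_i)`, written on exponent vectors. It is used only when
`x_i` divides `x^e`, so that the subtraction is exact. -/
noncomputable def borelMove {σ : Type*} (e : σ →₀ ℕ) (i j : σ) : σ →₀ ℕ :=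
  (e - Finsupp.single i 1) + Finsupp.single j 1

/-- The variables `x_i` are indexed by a poset `Q`. A monomial ideal `I` is `Q`-Borel if for every
monomial `m ∈ I`, every variable `x_i` dividing `m` and every `x_j ≤ x_i` in `Q`, the monomial
`x_j * (m / x_i)` lies in `I`. -/
def IsQBorel {Q K : Type*} [PartialOrder Q] [Field K] (I : Ideal (MvPolynomial Q K)) : Prop :=
  IsMonomialIdeal I ∧
    ∀ (e : Q →₀ ℕ) (i j : Q), MvPolynomial.monomial e (1 : K) ∈ I → e i ≠ 0 → j ≤ i →
      MvPolynomial.monomial (borelMove e i j) (1 : K) ∈ I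

/-- `Q(X)`: the smallest `Q`-Borel ideal that contains all monomials of `X`
(see `isLeast_qBorelIdeal`). -/
noncomputable def qBorelIdeal {Q : Type*} (K : Type*) [PartialOrder Q] [Field K] (X : Set (Q →₀ ℕ)) :
    Ideal (MvPolynomial Q K) :=
  sInf {I | IsQBorel I ∧ ∀ e ∈ X, MvPolynomial.monomial e (1 : K) ∈ I}

/-- The principal `Q`-Borel ideal `Q(m)` of the monomial `m = x^e`. -/
noncomputable def principalQBorelIdeal {Q : Type*} (K : Type*) [PartialOrder Q] [Field K] (e : Q →₀ ℕ) :
    Ideal (MvPolynomial Q K) :=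
  qBorelIdeal K {e}

/-- An ideal `I` has the persistence property if `ass(I^i) ⊆ ass(I^(i+1))` for all `i ≥ 1`. -/
def HasPersistenceProperty {R : Type*} [CommRing R] (I : Ideal R) : Prop :=
  ∀ i : ℕ, 1 ≤ i → Submodule.associatedPrimes (I ^ i) ⊆ Submodule.associatedPrimes (I ^ (i + 1))

/-- In a polynomial ring in finitely many variables, Mathlib's set of associated primes of an
ideal consists of the prime ideals of the form `I : ⟨f⟩ = {g | g * f ∈ I}`. -/
theorem mem_associatedPrimes_iff_colon {σ K : Type*} [Finite σ] [Field K]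
    (I P : Ideal (MvPolynomial σ K)) :
    P ∈ Submodule.associatedPrimes I ↔
      P.IsPrime ∧ ∃ f : MvPolynomial σ K, ∀ g : MvPolynomial σ K, g ∈ P ↔ g * f ∈ I := by
  rw [Submodule.AssociatePrimes.mem_iff, Submodule.isAssociatedPrime_iff]
  refine and_congr_right fun _ ↦ exists_congr fun f ↦ ?_
  rw [SetLike.ext_iff]
  refine forall_congr' fun g ↦ ?_
  rw [Submodule.mem_colon_singleton, smul_eq_mul]

theorem IsMonomialIdeal.monomial_mem {σ K : Type*} [Field K] {I : Ideal (MvPolynomial σ K)}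
    (hI : IsMonomialIdeal I) {f : MvPolynomial σ K} (hf : f ∈ I) {e : σ →₀ ℕ}
    (he : e ∈ f.support) : MvPolynomial.monomial e (1 : K) ∈ I := by
  classical
  obtain ⟨G, rfl⟩ := hI
  rw [MvPolynomial.mem_ideal_span_monomial_image] at hf ⊢
  intro a ha
  rw [MvPolynomial.support_monomial, if_neg one_ne_zero, Finset.mem_singleton] at ha
  exact ha ▸ hf e he

/-- `Q(X)` is indeed the smallest `Q`-Borel ideal that contains `X`. -/
theorem isLeast_qBorelIdeal {Q : Type*} (K : Type*) [PartialOrder Q] [Field K]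
    (X : Set (Q →₀ ℕ)) :
    IsLeast {I : Ideal (MvPolynomial Q K) |
      IsQBorel I ∧ ∀ e ∈ X, MvPolynomial.monomial e (1 : K) ∈ I} (qBorelIdeal K X) := by
  refine ⟨⟨⟨⟨{e | MvPolynomial.monomial e (1 : K) ∈ qBorelIdeal K X}, ?_⟩, ?_⟩, ?_⟩,
    fun I hI ↦ sInf_le hI⟩
  · apply le_antisymm
    · intro f hf
      rw [MvPolynomial.mem_ideal_span_monomial_image]
      intro a ha
      refine ⟨a, ?_, le_rfl⟩
      refine Submodule.mem_sInf.2 fun I hI ↦ ?_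
      exact hI.1.1.monomial_mem (Submodule.mem_sInf.1 hf I hI) ha
    · rw [Ideal.span_le]
      rintro _ ⟨e, he, rfl⟩
      exact he
  · intro e i j he hi hj
    exact Submodule.mem_sInf.2 fun I hI ↦ hI.1.2 e i j (Submodule.mem_sInf.1 he I hI) hi hj
  · intro e he
    exact Submodule.mem_sInf.2 fun I hI ↦ hI.2 e he

/-! `Q(m)` is a product of monomial primes: each factor `x_i` of `m` contributes the prime `(x_j : j
≤ i)`. For a product of primes `P_A`, `A ∈ M`, every associated prime is some `P_F`, and `P_F`
occurs exactly when the members of `M` inside `F` form a connected hypergraph on `F` (`IsLinked`).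
This condition depends only on which sets occur in `M`. Passing to the `s`-th power replaces `M` by
`s • M`, which has the same members, so nothing changes. The two directions of the criterion are
`isLinked_of_colon` and `IsLinked.exists_colon`; the reduction to monomial witnesses is
`mem_associatedPrimes_span_monomial_iff`. -/

open scoped Pointwise

/-- The monomial prime ideal generated by the variables of `A`. -/
noncomputable def varIdeal {σ : Type*} (K : Type*) [Field K] (A : Set σ) :
    Ideal (MvPolynomial σ K) :=
  Ideal.span (MvPolynomial.X '' A)

/-- The product of the monomial prime ideals of a finite family of sets of variables. -/
noncomputable def transversalIdeal {σ : Type*} (K : Type*) [Field K] (M : Multiset (Set σ)) :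
    Ideal (MvPolynomial σ K) :=
  (M.map (varIdeal K)).prod

/-- The exponents of the products of variables, one from each member of `M`. -/
def transversals {σ : Type*} (M : Multiset (Set σ)) : Set (σ →₀ ℕ) :=
  (M.map fun A ↦ (fun v ↦ Finsupp.single v 1) '' A).sum

/-! ### Monomial generators of products of monomial primes. -/

section Transversals

variable {σ K : Type*} [Field K] {M N : Multiset (Set σ)} {A F : Set σ} {d e : σ →₀ ℕ}

theorem mem_transversals_zero : d ∈ transversals (0 : Multiset (Set σ)) ↔ d = 0 := by
  simp [transversals]

theorem mem_transversals_cons :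
    d ∈ transversals (A ::ₘ M) ↔ ∃ v ∈ A, ∃ d' ∈ transversals M, Finsupp.single v 1 + d' = d := by
  simp [transversals, Set.mem_add]

theorem mem_transversals_add :
    d ∈ transversals (M + N) ↔ ∃ a ∈ transversals M, ∃ b ∈ transversals N, a + b = d := by
  simp [transversals, Set.mem_add]

theorem varIdeal_eq_span_monomial (A : Set σ) :
    varIdeal K A = Ideal.span ((fun e ↦ MvPolynomial.monomial e (1 : K)) ''
      ((fun v ↦ Finsupp.single v 1) '' A)) := by
  rw [Set.image_image]
  rfl

theorem mem_varIdeal {g : MvPolynomial σ K} :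
    g ∈ varIdeal K A ↔ ∀ a ∈ g.support, ∃ v ∈ A, a v ≠ 0 :=
  MvPolynomial.mem_ideal_span_X_image

theorem transversalIdeal_eq_span (M : Multiset (Set σ)) :
    transversalIdeal K M =
      Ideal.span ((fun e ↦ MvPolynomial.monomial e (1 : K)) '' transversals M) := by
  induction M using Multiset.induction_on with
  | empty =>
    have h : transversals (0 : Multiset (Set σ)) = {0} := Set.ext fun d ↦ mem_transversals_zero
    rw [h, Set.image_singleton]
    change (1 : Ideal (MvPolynomial σ K)) = Ideal.span {1}
    rw [Ideal.span_singleton_one, Ideal.one_eq_top]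
  | cons A M ih =>
    have h : transversalIdeal K (A ::ₘ M) = varIdeal K A * transversalIdeal K M := by
      simp [transversalIdeal]
    rw [h, ih, varIdeal_eq_span_monomial, Ideal.span_mul_span']
    congr 1
    ext f
    simp only [Set.mem_mul, Set.mem_image, mem_transversals_cons]
    constructor
    · rintro ⟨_, ⟨_, ⟨v, hv, rfl⟩, rfl⟩, _, ⟨d, hd, rfl⟩, rfl⟩
      exact ⟨_, ⟨v, hv, d, hd, rfl⟩, by simp [MvPolynomial.monomial_mul]⟩
    · rintro ⟨_, ⟨v, hv, d, hd, rfl⟩, rfl⟩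
      exact ⟨_, ⟨_, ⟨v, hv, rfl⟩, rfl⟩, _, ⟨d, hd, rfl⟩, by simp [MvPolynomial.monomial_mul]⟩

theorem transversalIdeal_nsmul (s : ℕ) (M : Multiset (Set σ)) :
    transversalIdeal K (s • M) = transversalIdeal K M ^ s := by
  rw [transversalIdeal, Multiset.map_nsmul, Multiset.prod_nsmul, transversalIdeal]

theorem monomial_mem_span_monomial {G : Set (σ →₀ ℕ)} :
    MvPolynomial.monomial e (1 : K) ∈
      Ideal.span ((fun e ↦ MvPolynomial.monomial e (1 : K)) '' G) ↔ ∃ d ∈ G, d ≤ e := by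
  classical
  rw [MvPolynomial.mem_ideal_span_monomial_image, MvPolynomial.support_monomial,
    if_neg one_ne_zero]
  simp

end Transversals

/-! ### Principal `Q`-Borel ideals as products of monomial primes. -/

section Borel

variable {Q K : Type*} [PartialOrder Q] [Field K]

/-- If `x_i` was chosen from `A`, then `x_j` may be chosen from `A` instead, because `A` is a lower
set. -/
theorem borelMove_mem_transversals {M : Multiset (Set Q)} (hM : ∀ A ∈ M, IsLowerSet A)
    {d : Q →₀ ℕ} (hd : d ∈ transversals M) {i j : Q} (hi : d i ≠ 0) (hj : j ≤ i) :
    borelMove d i j ∈ transversals M := by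
  classical
  induction M using Multiset.induction_on generalizing d with
  | empty =>
    rw [mem_transversals_zero] at hd
    simp [hd] at hi
  | cons A M ih =>
    obtain ⟨v, hv, d₀, hd₀, rfl⟩ := mem_transversals_cons.1 hd
    rw [mem_transversals_cons]
    by_cases hvi : v = i
    · subst hvi
      refine ⟨j, hM A (Multiset.mem_cons_self _ _) hj hv, d₀, hd₀, ?_⟩
      rw [borelMove, add_tsub_cancel_left, add_comm]
    · have hi' : d₀ i ≠ 0 := by simpa [Finsupp.single_apply, hvi] using hi
      refine ⟨v, hv, _, ih (fun A hA ↦ hM A (Multiset.mem_cons_of_mem hA)) hd₀ hi', ?_⟩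
      have : Finsupp.single i 1 ≤ d₀ := Finsupp.single_le_iff.2 (Nat.one_le_iff_ne_zero.2 hi')
      rw [borelMove, borelMove, add_tsub_assoc_of_le this, add_assoc]

theorem isQBorel_transversalIdeal {M : Multiset (Set Q)} (hM : ∀ A ∈ M, IsLowerSet A) :
    IsQBorel (transversalIdeal K M) := by
  rw [transversalIdeal_eq_span]
  refine ⟨⟨_, rfl⟩, fun e i j he hi hj ↦ ?_⟩
  rw [monomial_mem_span_monomial] at he ⊢
  obtain ⟨d, hd, hde⟩ := he
  -- If `x_i` does not divide the generator, the generator still divides the moved monomial;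
  -- otherwise the generator is moved too.
  by_cases hdi : d i = 0
  · refine ⟨d, hd, fun v ↦ ?_⟩
    have := hde v
    by_cases hv : i = v
    · subst hv
      simp [hdi]
    · simp [borelMove, hv]
      omega
  · exact ⟨_, borelMove_mem_transversals hM hd hdi hj,
      add_le_add_left (tsub_le_tsub_right hde _) _⟩

/-- Borel moves replace the factors of the monomial one at a time; `c` collects the variables
already replaced. -/
theorem monomial_mem_of_mem_transversals {J : Ideal (MvPolynomial Q K)} (hJ : IsQBorel J)
    (N : Multiset Q) {d : Q →₀ ℕ} (hd : d ∈ transversals (N.map Set.Iic)) (c : Q →₀ ℕ)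
    (hc : MvPolynomial.monomial ((N.map fun i ↦ Finsupp.single i 1).sum + c) (1 : K) ∈ J) :
    MvPolynomial.monomial (d + c) (1 : K) ∈ J := by
  induction N using Multiset.induction_on generalizing d c with
  | empty =>
    rw [Multiset.map_zero, mem_transversals_zero] at hd
    simpa [hd] using hc
  | cons i N ih =>
    rw [Multiset.map_cons] at hd
    obtain ⟨v, hv, d₀, hd₀, rfl⟩ := mem_transversals_cons.1 hd
    rw [Multiset.map_cons, Multiset.sum_cons] at hc
    have h := hJ.2 _ i v hc (by simp) hv
    rw [borelMove, add_assoc, add_tsub_cancel_left, add_assoc] at h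
    have := ih hd₀ (c + Finsupp.single v 1) h
    rwa [add_comm (Finsupp.single v 1), add_assoc, add_comm (Finsupp.single v 1)]

theorem sum_single_mem_transversals (N : Multiset Q) :
    (N.map fun i ↦ Finsupp.single i 1).sum ∈ transversals (N.map Set.Iic) := by
  induction N using Multiset.induction_on with
  | empty => simp [mem_transversals_zero]
  | cons i N ih =>
    rw [Multiset.map_cons, Multiset.map_cons, mem_transversals_cons]
    exact ⟨i, Set.mem_Iic.2 le_rfl, _, ih, by simp⟩

/-- The principal `Q`-Borel ideal of `x^m` is the product of the prime ideals
`(x_j : j ≤ i)`, each taken `m i` times. -/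
theorem principalQBorelIdeal_eq_transversalIdeal (m : Q →₀ ℕ) :
    principalQBorelIdeal K m = transversalIdeal K ((Finsupp.toMultiset m).map Set.Iic) := by
  classical
  have hm : ((Finsupp.toMultiset m).map fun i ↦ Finsupp.single i 1).sum = m := by
    induction m using Finsupp.induction_linear with
    | zero => simp
    | add f g hf hg => rw [map_add, Multiset.map_add, Multiset.sum_add, hf, hg]
    | single i n => simp [Finsupp.toMultiset_single, Multiset.map_nsmul, Multiset.sum_nsmul]
  refine (isLeast_qBorelIdeal K {m}).unique ⟨⟨?_, ?_⟩, fun J hJ ↦ ?_⟩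
  · refine isQBorel_transversalIdeal fun A hA ↦ ?_
    obtain ⟨i, -, rfl⟩ := Multiset.mem_map.1 hA
    exact isLowerSet_Iic i
  · rintro _ rfl
    rw [transversalIdeal_eq_span, monomial_mem_span_monomial]
    exact ⟨_, sum_single_mem_transversals _, hm.le⟩
  · rw [transversalIdeal_eq_span, Ideal.span_le]
    rintro _ ⟨d, hd, rfl⟩
    have := monomial_mem_of_mem_transversals hJ.1 _ hd 0 (by simpa [hm] using hJ.2 m rfl)
    simpa using this

end Borel

/-! ### Associated primes of monomial ideals. -/

section Associated

variable {σ K : Type*} [Field K]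

/-- It is the kernel of the substitution that kills the variables of `F`, and the target is a
domain. -/
theorem isPrime_varIdeal (F : Set σ) : (varIdeal K F).IsPrime := by
  classical
  let φ : MvPolynomial σ K →ₐ[K] MvPolynomial σ K :=
    MvPolynomial.aeval fun v ↦ if v ∈ F then 0 else MvPolynomial.X v
  have hφ : (Ideal.Quotient.mkₐ K (varIdeal K F)).comp φ = Ideal.Quotient.mkₐ K (varIdeal K F) := by
    refine MvPolynomial.algHom_ext fun v ↦ ?_
    by_cases hv : v ∈ F
    · have h : Ideal.Quotient.mk (varIdeal K F) (MvPolynomial.X v) = 0 :=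
        Ideal.Quotient.eq_zero_iff_mem.2 (Ideal.subset_span ⟨v, hv, rfl⟩)
      simp [φ, hv, h]
    · simp [φ, hv]
  have h : varIdeal K F = RingHom.ker φ := by
    refine le_antisymm (Ideal.span_le.2 ?_) fun g hg ↦ ?_
    · rintro _ ⟨v, hv, rfl⟩
      simp [φ, hv]
    · have := DFunLike.congr_fun hφ g
      rw [AlgHom.comp_apply, (RingHom.mem_ker).1 hg, map_zero] at this
      exact Ideal.Quotient.eq_zero_iff_mem.1 this.symm
  rw [h]
  exact RingHom.ker_isPrime _

theorem monomial_mem_of_isPrime {P : Ideal (MvPolynomial σ K)} (hP : P.IsPrime) {a : σ →₀ ℕ}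
    (ha : MvPolynomial.monomial a (1 : K) ∈ P) : ∃ v, a v ≠ 0 ∧ MvPolynomial.X v ∈ P := by
  rw [MvPolynomial.monomial_eq, map_one, one_mul, Finsupp.prod, hP.prod_mem_iff] at ha
  obtain ⟨v, hv, h⟩ := ha
  exact ⟨v, Finsupp.mem_support_iff.1 hv, hP.mem_of_pow_mem _ h⟩

theorem monomial_mem_iff_one {P : Ideal (MvPolynomial σ K)} {a : σ →₀ ℕ} {c : K} (hc : c ≠ 0) :
    MvPolynomial.monomial a c ∈ P ↔ MvPolynomial.monomial a (1 : K) ∈ P := by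
  have h : MvPolynomial.monomial a c = MvPolynomial.C c * MvPolynomial.monomial a (1 : K) := by
    rw [MvPolynomial.C_mul_monomial, mul_one]
  rw [h, Ideal.unit_mul_mem_iff_mem]
  exact (isUnit_iff_ne_zero.2 hc).map MvPolynomial.C

theorem support_sub_monomial_coeff_ssubset {f : MvPolynomial σ K} {a : σ →₀ ℕ}
    (ha : a ∈ f.support) :
    (f - MvPolynomial.monomial a (f.coeff a)).support ⊂ f.support := by
  classical
  refine (Finset.ssubset_iff_of_subset fun b hb ↦ ?_).2 ⟨a, ha, by simp⟩
  by_cases h : a = b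
  · exact h ▸ ha
  · simpa [MvPolynomial.coeff_monomial, h] using hb

/-- A prime ideal of the form `I : f`, for a monomial ideal `I`, is generated by variables. -/
theorem eq_varIdeal_of_colon [Finite σ] {I P : Ideal (MvPolynomial σ K)} (hI : IsMonomialIdeal I)
    (hP : P.IsPrime) (f : MvPolynomial σ K) (hf : ∀ g, g ∈ P ↔ g * f ∈ I) :
    P = varIdeal K {v | MvPolynomial.X v ∈ P} := by
  classical
  let _ : LinearOrder σ := IsWellOrder.linearOrder (WellOrderingRel (α := σ))
  let o : MonomialOrder σ := MonomialOrder.lex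
  refine le_antisymm ?_ (Ideal.span_le.2 (by rintro _ ⟨v, hv, rfl⟩; exact hv))
  -- Outer induction on the number of terms of `f`, inner one on that of `g`. Either the leading
  -- term of `g` lies in `P` and is stripped off, or `f` is replaced by a shorter polynomial with
  -- the same colon ideal.
  induction hn : f.support.card using Nat.strong_induction_on generalizing f with
  | _ n ihf =>
  intro g hg
  induction hk : g.support.card using Nat.strong_induction_on generalizing g with
  | _ k ihg =>
  by_cases hg0 : g = 0
  · rw [hg0]
    exact zero_mem _
  have hf0 : f ≠ 0 := by
    rintro rfl
    exact hP.ne_top ((Ideal.eq_top_iff_one _).2 ((hf 1).2 (by simp)))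
  by_cases ha : MvPolynomial.monomial (o.degree g) (1 : K) ∈ P
  · obtain ⟨v, hv, hvP⟩ := monomial_mem_of_isPrime hP ha
    have hlead : g.coeff (o.degree g) ≠ 0 := o.leadingCoeff_ne_zero_iff.2 hg0
    have hmem : MvPolynomial.monomial (o.degree g) (g.coeff (o.degree g)) ∈
        varIdeal K {v | MvPolynomial.X v ∈ P} := by
      rw [mem_varIdeal]
      intro a ha'
      rw [MvPolynomial.support_monomial, if_neg hlead, Finset.mem_singleton] at ha'
      exact ⟨v, hvP, ha' ▸ hv⟩
    have := ihg _ (hk ▸ Finset.card_lt_card (support_sub_monomial_coeff_ssubset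
      (MvPolynomial.mem_support_iff.2 hlead)))
      (P.sub_mem hg ((monomial_mem_iff_one hlead).2 ha)) rfl
    simpa using add_mem this hmem
  · set b := o.degree f with hb
    set a := o.degree g with ha_def
    have hlead : f.coeff b ≠ 0 := o.leadingCoeff_ne_zero_iff.2 hf0
    -- The leading monomial of `g * f` is a monomial of an element of the monomial ideal `I`.
    have hab : MvPolynomial.monomial (a + b) (1 : K) ∈ I := by
      refine hI.monomial_mem ((hf g).1 hg) ?_
      rw [ha_def, hb, ← o.degree_mul hg0 hf0]
      exact MvPolynomial.mem_support_iff.2 (o.leadingCoeff_ne_zero_iff.2 (mul_ne_zero hg0 hf0))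
    let f' := f - MvPolynomial.monomial b (f.coeff b)
    have hab' : MvPolynomial.monomial a (1 : K) * MvPolynomial.monomial b (f.coeff b) ∈ I := by
      rw [MvPolynomial.monomial_mul, one_mul]
      exact (monomial_mem_iff_one hlead).2 hab
    refine ihf _ ?_ (MvPolynomial.monomial a (1 : K) * f') (fun h ↦ ?_) rfl hg
    · refine (?_ : _ ≤ f'.support.card).trans_lt (hn ▸ Finset.card_lt_card
        (support_sub_monomial_coeff_ssubset (MvPolynomial.mem_support_iff.2 hlead)))
      refine (Finset.card_le_card (MvPolynomial.support_mul _ _)).trans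
        (Finset.card_add_le.trans ?_)
      rw [MvPolynomial.support_monomial, if_neg one_ne_zero, Finset.card_singleton, one_mul]
    -- Multiplying `f` by `x^a ∉ P` preserves the colon ideal since `P` is prime; dropping the
    -- leading term then changes the product only by an element of `I`.
    · have h1 : h ∈ P ↔ h * MvPolynomial.monomial a 1 ∈ P :=
        ⟨fun h' ↦ P.mul_mem_right _ h', fun h' ↦ (hP.mem_or_mem h').resolve_right ha⟩
      have h2 : h * (MvPolynomial.monomial a 1 * f') = h * MvPolynomial.monomial a 1 * f -
          h * (MvPolynomial.monomial a 1 * MvPolynomial.monomial b (f.coeff b)) := by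
        simp only [f']
        ring
      rw [h1, hf, h2, I.sub_mem_iff_left (I.mul_mem_left _ hab')]

theorem mem_support_mul_monomial {g : MvPolynomial σ K} {a e : σ →₀ ℕ} {c : K} (hc : c ≠ 0) :
    a ∈ (g * MvPolynomial.monomial e c).support ↔ ∃ b ∈ g.support, b + e = a := by
  classical
  simp only [MvPolynomial.mem_support_iff, MvPolynomial.coeff_mul_monomial', ne_eq]
  constructor
  · intro h
    split_ifs at h with hle
    · exact ⟨a - e, fun h' ↦ h (by simp [h']), tsub_add_cancel_of_le hle⟩
    · exact absurd rfl h
  · rintro ⟨b, hb, rfl⟩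
    simp [hb, hc]

/-- The associated primes of a monomial ideal are the ideals `I : u` generated by variables,
for `u` a monomial. -/
theorem mem_associatedPrimes_span_monomial_iff [Finite σ] {G : Set (σ →₀ ℕ)}
    {P : Ideal (MvPolynomial σ K)} :
    P ∈ Submodule.associatedPrimes
        (Ideal.span ((fun e ↦ MvPolynomial.monomial e (1 : K)) '' G)) ↔
      ∃ F, P = varIdeal K F ∧ ∃ e, ∀ a, (∃ d ∈ G, d ≤ a + e) ↔ ∃ v ∈ F, a v ≠ 0 := by
  classical
  set I := Ideal.span ((fun e ↦ MvPolynomial.monomial e (1 : K)) '' G) with hI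
  rw [mem_associatedPrimes_iff_colon]
  constructor
  · rintro ⟨hP, f, hf⟩
    have hPF := eq_varIdeal_of_colon ⟨G, hI⟩ hP f hf
    refine ⟨_, hPF, ?_⟩
    let J : (σ →₀ ℕ) → Ideal (MvPolynomial σ K) := fun e ↦
      I.colon {MvPolynomial.monomial e (1 : K)}
    -- `P` contains the finite intersection of the `I : x^e` over the monomials of `f`, so, being
    -- prime, it contains one of them.
    have hJ : f.support.inf J ≤ P := by
      intro g hg
      rw [hf, f.as_sum, Finset.mul_sum]
      refine I.sum_mem fun e he ↦ ?_
      have h := Submodule.mem_colon_singleton.1 ((Finset.inf_le he : f.support.inf J ≤ J e) hg)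
      have h' : MvPolynomial.monomial e (f.coeff e) =
          MvPolynomial.C (f.coeff e) * MvPolynomial.monomial e (1 : K) := by
        rw [MvPolynomial.C_mul_monomial, mul_one]
      rw [h', mul_left_comm]
      exact I.mul_mem_left _ h
    obtain ⟨e, he, heP⟩ := hP.inf_le'.1 hJ
    refine ⟨e, fun a ↦ ?_⟩
    rw [← monomial_mem_span_monomial (K := K), ← hI]
    constructor
    · intro h
      have : MvPolynomial.monomial a (1 : K) ∈ P := heP <| Submodule.mem_colon_singleton.2 <| by
        rwa [smul_eq_mul, MvPolynomial.monomial_mul, one_mul]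
      obtain ⟨v, hv, hvP⟩ := monomial_mem_of_isPrime hP this
      exact ⟨v, hvP, hv⟩
    · rintro ⟨v, hv, hav⟩
      have h : MvPolynomial.monomial (e + Finsupp.single v 1) (1 : K) ∈ I := by
        refine IsMonomialIdeal.monomial_mem ⟨G, hI⟩ ((hf _).1 hv) ?_
        rw [mul_comm]
        exact (mem_support_mul_monomial one_ne_zero).2 ⟨e, he, rfl⟩
      have hle : Finsupp.single v 1 ≤ a := Finsupp.single_le_iff.2 (Nat.one_le_iff_ne_zero.2 hav)
      have h' : MvPolynomial.monomial (a + e) (1 : K) = MvPolynomial.monomial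
          (a - Finsupp.single v 1) 1 * MvPolynomial.monomial (e + Finsupp.single v 1) 1 := by
        rw [MvPolynomial.monomial_mul, one_mul, add_comm e, ← add_assoc, tsub_add_cancel_of_le hle]
      rw [h']
      exact I.mul_mem_left _ h
  · rintro ⟨F, rfl, e, he⟩
    refine ⟨isPrime_varIdeal F, MvPolynomial.monomial e 1, fun g ↦ ?_⟩
    rw [mem_varIdeal, hI, MvPolynomial.mem_ideal_span_monomial_image]
    constructor
    · intro h a ha
      obtain ⟨b, hb, rfl⟩ := (mem_support_mul_monomial one_ne_zero).1 ha
      exact (he b).2 (h b hb)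
    · exact fun h a ha ↦ (he a).1 (h _ ((mem_support_mul_monomial one_ne_zero).2 ⟨a, ha, rfl⟩))

end Associated

/-! ### Associated primes of products of monomial primes via connectedness. -/

section Linked

variable {σ K : Type*} [Field K] {M N : Multiset (Set σ)} {A F G : Set σ} {d e : σ →₀ ℕ}

/-- Some member of `M` lies in `F`, and `F` has no partition into two nonempty parts
such that each member of `M` that lies in `F` lies in one of the parts. -/
def IsLinked (M : Multiset (Set σ)) (F : Set σ) : Prop :=
  (∃ A ∈ M, A ⊆ F) ∧
    ∀ G ⊂ F, G.Nonempty → ∃ A ∈ M, A ⊆ F ∧ (A ∩ G).Nonempty ∧ (A \ G).Nonempty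

theorem transversals_apply_eq_zero {v : σ} (hv : ∀ A ∈ M, v ∉ A) (hd : d ∈ transversals M) :
    d v = 0 := by
  classical
  induction M using Multiset.induction_on generalizing d with
  | empty => simp [mem_transversals_zero.1 hd]
  | cons A M ih =>
    obtain ⟨w, hw, d₀, hd₀, rfl⟩ := mem_transversals_cons.1 hd
    have hwv : w ≠ v := by
      rintro rfl
      exact hv A (Multiset.mem_cons_self _ _) hw
    simp [hwv, ih (fun A hA ↦ hv A (Multiset.mem_cons_of_mem hA)) hd₀]

theorem card_le_sum_of_mem_transversals (F : Finset σ) (hM : ∀ A ∈ M, A ⊆ F)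
    (hd : d ∈ transversals M) : M.card ≤ ∑ v ∈ F, d v := by
  classical
  induction M using Multiset.induction_on generalizing d with
  | empty => simp
  | cons A M ih =>
    obtain ⟨w, hw, d₀, hd₀, rfl⟩ := mem_transversals_cons.1 hd
    have hwF : w ∈ F := hM A (Multiset.mem_cons_self _ _) hw
    have := ih (fun A hA ↦ hM A (Multiset.mem_cons_of_mem hA)) hd₀
    simp [Finset.sum_add_distrib, Finsupp.single_apply, hwF]
    omega

theorem exists_transversal_avoiding (F : Set σ) (hM : ∀ A ∈ M, ¬ A ⊆ F) :
    ∃ d ∈ transversals M, ∀ v ∈ F, d v = 0 := by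
  classical
  induction M using Multiset.induction_on with
  | empty => exact ⟨0, mem_transversals_zero.2 rfl, by simp⟩
  | cons A M ih =>
    obtain ⟨d, hd, hdF⟩ := ih fun A hA ↦ hM A (Multiset.mem_cons_of_mem hA)
    obtain ⟨w, hw, hwF⟩ := Set.not_subset.1 (hM A (Multiset.mem_cons_self _ _))
    refine ⟨_, mem_transversals_cons.2 ⟨w, hw, d, hd, rfl⟩, fun v hv ↦ ?_⟩
    have hwv : w ≠ v := by
      rintro rfl
      exact hwF hv
    simp [hwv, hdF v hv]

/-- If `F` split into `G` and `F \ G`, the members inside `F` would split too. Each half misses a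
variable of `F`, so has a transversal dividing `x^e`; the supports are disjoint, so the product
divides `x^e`, which `hnot` forbids. -/
theorem isLinked_of_colon (hM : ∀ A ∈ M, A.Nonempty)
    (he : ∀ a, (∃ d ∈ transversals M, d ≤ a + e) ↔ ∃ v ∈ F, a v ≠ 0) : IsLinked M F := by
  classical
  obtain ⟨w, hw, hwF⟩ := exists_transversal_avoiding (M := M.filter fun A ↦ ¬ A ⊆ F) F
    fun A hA ↦ (Multiset.mem_filter.1 hA).2
  have hsplit := Multiset.filter_add_not (fun A ↦ A ⊆ F) M
  set C := M.filter fun A ↦ A ⊆ F with hC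
  -- no transversal of `C` divides `e`
  have hnot : ∀ d ∈ transversals C, ¬ d ≤ e := by
    intro d hd hde
    obtain ⟨v, hv, h⟩ := (he w).1 ⟨d + w, hsplit ▸ mem_transversals_add.2 ⟨d, hd, w, hw, rfl⟩,
      by rw [add_comm w]; exact add_le_add_left hde w⟩
    exact h (hwF v hv)
  -- a submultiset that misses `v ∈ F` has a transversal dividing `e`
  have hdiv : ∀ C' ≤ M, ∀ v ∈ F, (∀ A ∈ C', v ∉ A) → ∃ d ∈ transversals C', d ≤ e := by
    intro C' hC' v hv hvC
    obtain ⟨d, hd, hde⟩ := (he (Finsupp.single v 1)).2 ⟨v, hv, by simp⟩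
    obtain ⟨D, rfl⟩ := Multiset.le_iff_exists_add.1 hC'
    obtain ⟨d₁, hd₁, d₂, hd₂, rfl⟩ := mem_transversals_add.1 hd
    refine ⟨d₁, hd₁, fun u ↦ ?_⟩
    by_cases huv : v = u
    · subst huv
      simp [transversals_apply_eq_zero hvC hd₁]
    · have := hde u
      simp [huv] at this
      omega
  refine ⟨?_, fun G hGF hG ↦ ?_⟩
  · by_contra! h
    have : C = 0 := Multiset.filter_eq_nil.2 h
    exact hnot 0 (this ▸ mem_transversals_zero.2 rfl) zero_le
  · by_contra! h
    obtain ⟨v, hvG⟩ := hG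
    obtain ⟨v', hv'F, hv'G⟩ := Set.exists_of_ssubset hGF
    have hsplit' := Multiset.filter_add_not (fun A ↦ A ⊆ G) C
    have hCM : C ≤ M := Multiset.filter_le _ _
    have hC₂ : ∀ A ∈ C.filter fun A ↦ ¬ A ⊆ G, ∀ u ∈ G, u ∉ A := by
      intro A hA u hu huA
      obtain ⟨hA, hAG⟩ := Multiset.mem_filter.1 hA
      obtain ⟨hA, hAF⟩ := Multiset.mem_filter.1 hA
      exact hAG (Set.sdiff_eq_empty.1 (h A hA hAF ⟨u, huA, hu⟩))
    have hC₁ : ∀ A ∈ C.filter fun A ↦ A ⊆ G, ∀ u ∉ G, u ∉ A := fun A hA u hu huA ↦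
      hu ((Multiset.mem_filter.1 hA).2 huA)
    obtain ⟨d₁, hd₁, hle₁⟩ := hdiv _ ((Multiset.filter_le _ _).trans hCM) v' hv'F
      fun A hA ↦ hC₁ A hA v' hv'G
    obtain ⟨d₂, hd₂, hle₂⟩ := hdiv _ ((Multiset.filter_le _ _).trans hCM) v (hGF.subset hvG)
      fun A hA ↦ hC₂ A hA v hvG
    refine hnot (d₁ + d₂) (hsplit' ▸ mem_transversals_add.2 ⟨d₁, hd₁, d₂, hd₂, rfl⟩) fun u ↦ ?_
    by_cases hu : u ∈ G
    · simpa [transversals_apply_eq_zero (fun A hA ↦ hC₂ A hA u hu) hd₂] using hle₁ u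
    · simpa [transversals_apply_eq_zero (fun A hA ↦ hC₁ A hA u hu) hd₁] using hle₂ u

/-- In a linked family there are subfamilies `D` of every size `k + 1` and monomials `u` of
degree `k` such that `x_v * u` lies in the ideal of `D` for each variable `x_v` of `D`. -/
theorem exists_colon_witness {C : Multiset (Set σ)} (F : Finset σ)
    (hne : ∀ A ∈ C, A.Nonempty) (hCF : ∀ A ∈ C, A ⊆ F) (hC : IsLinked C F) (k : ℕ)
    (hk : k + 1 ≤ C.card) :
    ∃ D ≤ C, D.card = k + 1 ∧ ∃ u : σ →₀ ℕ, ∑ v ∈ F, u v = k ∧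
      ∀ v, (∃ A ∈ D, v ∈ A) → ∃ d ∈ transversals D, d ≤ Finsupp.single v 1 + u := by
  classical
  induction k with
  | zero =>
    obtain ⟨⟨A, hA, -⟩, -⟩ := hC
    refine ⟨{A}, Multiset.singleton_le.2 hA, rfl, 0, by simp, fun v hv ↦ ?_⟩
    obtain ⟨B, hB, hvB⟩ := hv
    rw [Multiset.mem_singleton.1 hB] at hvB
    refine ⟨Finsupp.single v 1, ?_, by simp⟩
    rw [← Multiset.cons_zero, mem_transversals_cons]
    exact ⟨v, hvB, 0, mem_transversals_zero.2 rfl, add_zero _⟩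
  | succ k ih =>
    obtain ⟨D, hDC, hDk, u, hu, hD⟩ := ih (by omega)
    obtain ⟨E, rfl⟩ := Multiset.le_iff_exists_add.1 hDC
    -- Connectedness yields an unused member `A` sharing a variable `x_w` with `D`; `A` joins `D`,
    -- and `u` is multiplied by `x_w`.
    have hstep : ∃ A ∈ E, ∃ w ∈ A, ∃ B ∈ D, w ∈ B := by
      set U : Set σ := {v | ∃ B ∈ D, v ∈ B} with hU
      have hUF : U ⊆ F := by
        rintro v ⟨B, hB, hvB⟩
        exact hCF B (Multiset.mem_add.2 (Or.inl hB)) hvB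
      by_cases hUF' : U = F
      · obtain ⟨A, hA⟩ : ∃ A, A ∈ E := Multiset.card_pos_iff_exists_mem.1 (by
          rw [Multiset.card_add] at hk
          omega)
        obtain ⟨w, hw⟩ := hne A (Multiset.mem_add.2 (Or.inr hA))
        have : w ∈ U := hUF' ▸ hCF A (Multiset.mem_add.2 (Or.inr hA)) hw
        exact ⟨A, hA, w, hw, this⟩
      · have hUne : U.Nonempty := by
          obtain ⟨B, hB⟩ : ∃ B, B ∈ D := Multiset.card_pos_iff_exists_mem.1 (by omega)
          obtain ⟨w, hw⟩ := hne B (Multiset.mem_add.2 (Or.inl hB))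
          exact ⟨w, B, hB, hw⟩
        obtain ⟨A, hA, -, ⟨w, hwA, hwU⟩, ⟨z, hzA, hzU⟩⟩ :=
          hC.2 U (hUF.ssubset_of_ne hUF') hUne
        refine ⟨A, (Multiset.mem_add.1 hA).resolve_left fun h ↦ hzU ⟨A, h, hzA⟩, w, hwA, hwU⟩
    obtain ⟨A, hA, w, hwA, hwD⟩ := hstep
    have hwF : w ∈ F := hCF A (Multiset.mem_add.2 (Or.inr hA)) hwA
    refine ⟨A ::ₘ D, ?_, by simp [hDk], u + Finsupp.single w 1, ?_, ?_⟩
    · rw [← Multiset.singleton_add, add_comm]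
      exact add_le_add_right (Multiset.singleton_le.2 hA) D
    · simp [Finset.sum_add_distrib, Finsupp.single_apply, hwF, hu]
    · rintro v ⟨B, hB, hvB⟩
      -- For `v ∈ A`, take `x_v` from `A` and use `x_w * u` for `D`; for `v` in `D`, take `x_w` from
      -- `A` and use `x_v * u`.
      rcases Multiset.mem_cons.1 hB with rfl | hB
      · obtain ⟨d, hd, hle⟩ := hD w hwD
        refine ⟨_, mem_transversals_cons.2 ⟨v, hvB, d, hd, rfl⟩, ?_⟩
        rw [add_comm u]
        exact add_le_add_right hle _
      · obtain ⟨d, hd, hle⟩ := hD v ⟨B, hB, hvB⟩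
        refine ⟨_, mem_transversals_cons.2 ⟨w, hwA, d, hd, rfl⟩, ?_⟩
        rw [← add_assoc, add_comm]
        exact add_le_add_left hle _

/-- The witness is `u * w`: `w` handles the members not inside `F` without using variables of `F`,
and `u` has degree one less than the number of members inside `F`. -/
theorem IsLinked.exists_colon [Finite σ] (hM : ∀ A ∈ M, A.Nonempty) (hF : IsLinked M F) :
    ∃ e, ∀ a, (∃ d ∈ transversals M, d ≤ a + e) ↔ ∃ v ∈ F, a v ≠ 0 := by
  classical
  obtain ⟨F, rfl⟩ := (Set.toFinite F).exists_finset_coe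
  obtain ⟨w, hw, hwF⟩ := exists_transversal_avoiding (M := M.filter fun A ↦ ¬ A ⊆ F) F
    fun A hA ↦ (Multiset.mem_filter.1 hA).2
  have hsplit := Multiset.filter_add_not (fun A ↦ A ⊆ (F : Set σ)) M
  set C := M.filter fun A ↦ A ⊆ (F : Set σ) with hC
  have hCF : ∀ A ∈ C, A ⊆ F := fun A hA ↦ (Multiset.mem_filter.1 hA).2
  have hne : ∀ A ∈ C, A.Nonempty := fun A hA ↦ hM A (Multiset.mem_filter.1 hA).1
  have hlink : IsLinked C F := by
    refine ⟨?_, fun G hG hG' ↦ ?_⟩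
    · obtain ⟨A, hA, hAF⟩ := hF.1
      exact ⟨A, Multiset.mem_filter.2 ⟨hA, hAF⟩, hAF⟩
    · obtain ⟨A, hA, hAF, h⟩ := hF.2 G hG hG'
      exact ⟨A, Multiset.mem_filter.2 ⟨hA, hAF⟩, hAF, h⟩
  have hpos : 0 < C.card := Multiset.card_pos_iff_exists_mem.2 (hlink.1.imp fun A hA ↦ hA.1)
  have hcover : ∀ v ∈ F, ∃ A ∈ C, v ∈ A := by
    intro v hv
    by_cases h : F = {v}
    · obtain ⟨A, hA, hAF⟩ := hlink.1
      obtain ⟨z, hz⟩ := hne A hA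
      have : z ∈ F := hAF hz
      rw [h, Finset.mem_singleton] at this
      exact ⟨A, hA, this ▸ hz⟩
    · obtain ⟨A, hA, -, ⟨z, hz, hzv⟩, -⟩ := hlink.2 {v} ((Set.singleton_subset_iff.2 hv).ssubset_of_ne
        fun h' ↦ h (by rw [← Finset.coe_inj, ← h', Finset.coe_singleton]))
        (Set.singleton_nonempty v)
      exact ⟨A, hA, Set.mem_singleton_iff.1 hzv ▸ hz⟩
  obtain ⟨D, hDC, hDk, u, hu, hD⟩ := exists_colon_witness F hne hCF hlink (C.card - 1) (by omega)
  -- With `k + 1 = C.card` the subfamily is all of `C`.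
  obtain rfl := Multiset.eq_of_le_of_card_le hDC (by omega)
  refine ⟨u + w, fun a ↦ ⟨?_, ?_⟩⟩
  · rintro ⟨d, hd, hle⟩
    by_contra! h
    rw [← hsplit] at hd
    obtain ⟨d₁, hd₁, d₂, -, rfl⟩ := mem_transversals_add.1 hd
    -- Degree count on `F`: a transversal of `C` has degree at least `C.card`, but only `u`, of
    -- degree `C.card - 1`, contributes there.
    have h₁ := card_le_sum_of_mem_transversals F hCF hd₁
    have h₂ : ∑ v ∈ F, d₁ v ≤ ∑ v ∈ F, u v := Finset.sum_le_sum fun v hv ↦ by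
      have := hle v
      simp [h v hv, hwF v hv] at this
      omega
    omega
  · rintro ⟨v, hv, hav⟩
    obtain ⟨d, hd, hle⟩ := hD v (hcover v hv)
    refine ⟨d + w, hsplit ▸ mem_transversals_add.2 ⟨d, hd, w, hw, rfl⟩, ?_⟩
    rw [← add_assoc]
    have hva : Finsupp.single v 1 ≤ a := Finsupp.single_le_iff.2 (Nat.one_le_iff_ne_zero.2 hav)
    exact add_le_add_left (hle.trans (add_le_add_left hva u)) w

/-- The associated primes of a product of monomial prime ideals. -/
theorem mem_associatedPrimes_transversalIdeal_iff [Finite σ] (hM : ∀ A ∈ M, A.Nonempty)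
    {P : Ideal (MvPolynomial σ K)} :
    P ∈ Submodule.associatedPrimes (transversalIdeal K M) ↔
      ∃ F, P = varIdeal K F ∧ IsLinked M F := by
  rw [transversalIdeal_eq_span, mem_associatedPrimes_span_monomial_iff]
  exact exists_congr fun F ↦ and_congr_right fun _ ↦
    ⟨fun ⟨_, he⟩ ↦ isLinked_of_colon hM he, fun h ↦ h.exists_colon hM⟩

theorem associatedPrimes_transversalIdeal_pow [Finite σ] (hM : ∀ A ∈ M, A.Nonempty) {s : ℕ}
    (hs : s ≠ 0) :
    Submodule.associatedPrimes (transversalIdeal K M ^ s) =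
      Submodule.associatedPrimes (transversalIdeal K M) := by
  have hmem : ∀ A, A ∈ s • M ↔ A ∈ M := fun A ↦ by simp [Multiset.mem_nsmul, hs]
  ext P
  rw [← transversalIdeal_nsmul, mem_associatedPrimes_transversalIdeal_iff hM,
    mem_associatedPrimes_transversalIdeal_iff fun A hA ↦ hM A ((hmem A).1 hA)]
  simp only [IsLinked, hmem]

end Linked

theorem mainTheorem3 {Q K : Type*} [Finite Q] [PartialOrder Q] [Field K] (m : Q →₀ ℕ) :
    (∀ s : ℕ, 1 ≤ s →
      Submodule.associatedPrimes (principalQBorelIdeal K m) =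
        Submodule.associatedPrimes (principalQBorelIdeal K m ^ s)) ∧
    HasPersistenceProperty (principalQBorelIdeal K m) := by
  have key : ∀ s : ℕ, 1 ≤ s →
      Submodule.associatedPrimes (principalQBorelIdeal K m) =
        Submodule.associatedPrimes (principalQBorelIdeal K m ^ s) := by
    intro s hs
    rw [principalQBorelIdeal_eq_transversalIdeal]
    refine (associatedPrimes_transversalIdeal_pow (fun A hA ↦ ?_) (by omega)).symm
    obtain ⟨i, -, rfl⟩ := Multiset.mem_map.1 hA
    exact ⟨i, Set.mem_Iic.2 le_rfl⟩
  exact ⟨key, fun i hi ↦ by rw [← key i hi, ← key (i + 1) (by omega)]⟩
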